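/- **Proposition.** The co-chromatic threshold of the family of $S(7)$-free $3$-uniform hypergraphs is at least $2/5$. Here all hypergraphs are finite, and $S(7)$ is the Fano plane, i.e. the $3$-uniform hypergraph with vertex set $\mathbb{Z}/7\mathbb{Z}$ and the seven edges $\{i,i+1,i+3\}$, $i\in\mathbb{Z}/7\mathbb{Z}$. A hypergraph $H$ is $S(7)$-free if there is no injection $V(S(7))\to V(H)$ mapping every edge of $S(7)$ to an edge of $H$. The chromatic number $\chi(H)$ is the least $k$ for which there is a map $V(H)\to\{1,\dots,k\}$ that is not constant on any edge. The co-degree of a set of two vertices $x,y$ of a $3$-uniform hypergraph $H$ is $|\{z:\{x,y,z\}\in E(H)\}|$, and the minimum co-degree of $H$ is the minimum of the co-degrees of its pairs of distinct vertices (with no constraint if $|V(H)|\le 1$). The co-chromatic threshold of a family $\mathcal{F}$ of $3$-uniform hypergraphs is the infimum of the values $c\ge 0$ such that the members $H$ of $\mathcal{F}$ with minimum co-degree at least $c\,|V(H)|$ have bounded chromatic number. -/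

import Mathlib

namespace Hypergraph

/-- Every edge of `H` has exactly `r` elements. -/
def IsUniform {V : Type*} (H : Hypergraph V) (r : ℕ) : Prop :=
  ∀ e ∈ H.edgeSet, e.encard = (r : ℕ∞)

/-- There is a map from the vertices of `H` to `{0, …, k - 1}` under which no edge of `H` is
monochromatic. -/
def IsColorable {V : Type*} (H : Hypergraph V) (k : ℕ) : Prop :=
  ∃ f : H.vertexSet → Fin k, ∀ e ∈ H.edgeSet,
    ∃ u v : H.vertexSet, (u : V) ∈ e ∧ (v : V) ∈ e ∧ f u ≠ f v

/-- The chromatic number: the least `k` such that `H` is `k`-colorable (`⊤` if there is none). -/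
noncomputable def chromaticNumber {V : Type*} (H : Hypergraph V) : ℕ∞ :=
  ⨅ k ∈ {k : ℕ | H.IsColorable k}, (k : ℕ∞)

/-- The co-degree of a set `S` of vertices: the number of `z` such that `S ∪ {z}` is an edge.
It is used for sets `S` of `r - 1` vertices in `r`-uniform hypergraphs with finitely many
vertices, where `z ∈ S` cannot contribute. -/
noncomputable def coDegree {V : Type*} (H : Hypergraph V) (S : Set V) : ℕ :=
  {z : V | insert z S ∈ H.edgeSet}.ncard

/-- `F` is a (not necessarily induced) subhypergraph of `H`: there is an injection from the
vertices of `F` to the vertices of `H` that maps every edge of `F` to an edge of `H`. -/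
def IsContainedIn {V W : Type*} (F : Hypergraph V) (H : Hypergraph W) : Prop :=
  ∃ f : F.vertexSet → H.vertexSet, Function.Injective f ∧
    ∀ e ∈ F.edgeSet, (fun v : F.vertexSet => (f v : W)) '' {v | (v : V) ∈ e} ∈ H.edgeSet

end Hypergraph

/-- An `r`-uniform hypergraph with a finite vertex set. -/
structure UniformHypergraph (r : ℕ) where
  /-- A type containing the vertices. -/
  carrier : Type
  /-- The hypergraph. -/
  graph : Hypergraph carrier
  finite : graph.vertexSet.Finite
  uniform : graph.IsUniform r

namespace UniformHypergraph

/-- The minimum co-degree of `H` (the minimum over all sets of `r - 1` vertices) is at least `x`.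
If there is no set of `r - 1` vertices, then there is no constraint. -/
def MinCoDegreeGE {r : ℕ} (H : UniformHypergraph r) (x : ℝ) : Prop :=
  ∀ S : Set H.carrier, S ⊆ H.graph.vertexSet → S.encard + 1 = (r : ℕ∞) →
    x ≤ (H.graph.coDegree S : ℝ)

/-- The family of `A`-free `r`-uniform hypergraphs. -/
def freeFamily {r : ℕ} (A : UniformHypergraph r) : Set (UniformHypergraph r) :=
  {H | ¬ A.graph.IsContainedIn H.graph}

/-- The co-chromatic threshold of a family `F` of `r`-uniform hypergraphs: the infimum of the
`c ≥ 0` such that the members `H` of `F` with minimum co-degree at least `c |V(H)|` have bounded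
chromatic number. -/
noncomputable def coChromaticThreshold {r : ℕ} (F : Set (UniformHypergraph r)) : ℝ :=
  sInf {c : ℝ | 0 ≤ c ∧ ∃ t : ℕ, ∀ H ∈ F,
    H.MinCoDegreeGE (c * (H.graph.vertexSet.ncard : ℝ)) → H.graph.chromaticNumber ≤ (t : ℕ∞)}

/-- The Fano plane `S(7)`: the points are the integers modulo `7`, and the lines are the
translates of `{0, 1, 3}`. -/
def fano : UniformHypergraph 3 where
  carrier := ZMod 7
  graph :=
    { vertexSet := Set.univ
      edgeSet := Set.range fun i : ZMod 7 => ({i, i + 1, i + 3} : Set (ZMod 7))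
      subset_vertexSet_of_mem_edgeSet' := fun _ _ => Set.subset_univ _ }
  finite := by
    have : Finite (ZMod 7) := inferInstanceAs (Finite (Fin 7))
    exact Set.toFinite _
  uniform := by
    rintro e ⟨i, rfl⟩
    have h := (by decide : ∀ i : ZMod 7, i ≠ i + 1 ∧ i ≠ i + 3 ∧ i + 1 ≠ i + 3) i
    exact Set.encard_eq_three.mpr ⟨i, i + 1, i + 3, h.1, h.2.1, h.2.2, rfl⟩

end UniformHypergraph

/-! Take W = 𝔽₃ⁿ with its zero-sum triples (the affine lines) as edges, and add classes P and Q of N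
vertices each, with all triples of types PPQ, PQQ, PQW and PWW, but not PPW. Hales–Jewett makes the
chromatic number exceed any t for large n, whatever N is. Pairs meeting P extend by Q and all others
by P, so co-degrees are at least N - 1 among |W| + 2N vertices. No Fano plane embeds: splitting its
points by membership in P leaves a monochromatic line, which must be a zero-sum triple of W. Since
PPW is excluded, at most one of the other four points is in P; three that are not form with the line
a Pasch configuration of zero-sum triples, which 𝔽₃ⁿ does not contain (`eq_of_pasch`). -/

namespace Combinatorics.Line

/-- An active coordinate contributes 0 + 1 + 2 and a fixed one 3a; both vanish modulo 3. -/
lemma sum_apply_zmod_three {ι : Type*} (l : Line (ZMod 3) ι) : l 0 + l 1 + l 2 = 0 := by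
  funext i
  simp only [Pi.add_apply, Pi.zero_apply, Line.coe_apply]
  cases l.idxFun i with
  | none => simp only [Option.getD_none]; decide
  | some a => simp only [Option.getD_some]; revert a; decide

lemma apply_injective {α ι : Type*} (l : Line α ι) : Function.Injective fun x => l x := by
  intro a b h
  obtain ⟨i, hi⟩ := l.proper
  simpa [Line.coe_apply, hi] using congrFun h i

end Combinatorics.Line

/-- The affine spaces over `𝔽₃` contain no Pasch configuration. -/
lemma eq_of_pasch {ι : Type*} {a b c a' b' c' : ι → ZMod 3} (h₁ : a + b + c = 0)
    (h₂ : a + b' + c' = 0) (h₃ : a' + b + c' = 0) (h₄ : a' + b' + c = 0) : a = a' := by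
  funext i
  have e₁ := congrFun h₁ i
  have e₂ := congrFun h₂ i
  have e₃ := congrFun h₃ i
  have e₄ := congrFun h₄ i
  simp only [Pi.add_apply, Pi.zero_apply] at e₁ e₂ e₃ e₄
  have h3 : (3 : ZMod 3) = 0 := by decide
  -- The doubled combination equals 4(a - a'), which is a - a' modulo 3.
  linear_combination 2 * e₁ + 2 * e₂ - 2 * e₃ - 2 * e₄ - (a i - a' i) * h3

/-- Every 2-coloring of the Fano plane has a monochromatic line. -/
lemma exists_mono_fano_line (p : ZMod 7 → Prop) :
    ∃ i, (p i ∧ p (i + 1) ∧ p (i + 3)) ∨ (¬ p i ∧ ¬ p (i + 1) ∧ ¬ p (i + 3)) := by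
  classical
  have key : ∀ c : ZMod 7 → Bool, ∃ i, c i = c (i + 1) ∧ c i = c (i + 3) := by
    decide +kernel
  obtain ⟨i, h₁, h₃⟩ := key fun j => decide (p j)
  have h₁' := decide_eq_decide.mp h₁
  have h₃' := decide_eq_decide.mp h₃
  refine ⟨i, ?_⟩
  by_cases hp : p i
  · exact Or.inl ⟨hp, h₁'.mp hp, h₃'.mp hp⟩
  · exact Or.inr ⟨hp, mt h₁'.mpr hp, mt h₃'.mpr hp⟩

namespace Hypergraph

lemma IsColorable.mono {V : Type*} {H : Hypergraph V} {k t : ℕ} (h : H.IsColorable k)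
    (hkt : k ≤ t) : H.IsColorable t := by
  obtain ⟨f, hf⟩ := h
  refine ⟨fun v => Fin.castLE hkt (f v), fun e he => ?_⟩
  obtain ⟨u, v, hu, hv, huv⟩ := hf e he
  exact ⟨u, v, hu, hv, fun h => huv (Fin.castLE_injective hkt h)⟩

lemma isColorable_of_chromaticNumber_le {V : Type*} {H : Hypergraph V} {t : ℕ}
    (h : H.chromaticNumber ≤ (t : ℕ∞)) : H.IsColorable t := by
  by_contra hc
  have : ((t + 1 : ℕ) : ℕ∞) ≤ H.chromaticNumber := by
    refine le_iInf₂ fun k hk => ?_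
    have : t < k := by
      by_contra! hkt
      exact hc (IsColorable.mono hk hkt)
    exact_mod_cast this
  have := this.trans h
  norm_cast at this
  omega

end Hypergraph

namespace UniformHypergraph

/-! ### The construction and its co-degrees -/

section Extension

variable (W : Type) (N : ℕ)

/-- The vertices of `W` and two further classes `P` and `Q` of `N` vertices each. -/
abbrev ExtVertex := W ⊕ (Fin N ⊕ Fin N)

variable {W N}

/-- The vertex lies in the class `W`. -/
def InW (v : ExtVertex W N) : Prop := ∃ w, v = Sum.inl w

/-- The vertex lies in the class `P`. -/
def InP (v : ExtVertex W N) : Prop := ∃ p, v = Sum.inr (Sum.inl p)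

/-- The set meets `P` and its complement, and it has only one point in `P` if it meets `W`. -/
def IsCrossing (e : Set (ExtVertex W N)) : Prop :=
  (∃ v ∈ e, InP v) ∧ (∃ v ∈ e, ¬ InP v) ∧
    ((∃ v ∈ e, InW v) → ∀ u ∈ e, ∀ v ∈ e, InP u → InP v → u = v)

lemma InP.not_inW {v : ExtVertex W N} (h : InP v) : ¬ InW v := by
  obtain ⟨p, rfl⟩ := h
  rintro ⟨w, hw⟩
  cases hw

lemma isCrossing_triple {p q r : ExtVertex W N} (hp : InP p) (hq : ¬ InP q)
    (h : InP r → ¬ InW q) : IsCrossing ({p, q, r} : Set (ExtVertex W N)) := by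
  refine ⟨⟨p, by simp, hp⟩, ⟨q, by simp, hq⟩, fun ⟨w, hw, hwW⟩ => ?_⟩
  have hr : ¬ InP r := by
    intro hr
    rcases hw with rfl | rfl | rfl
    · exact hp.not_inW hwW
    · exact h hr hwW
    · exact hr.not_inW hwW
  have key : ∀ a ∈ ({p, q, r} : Set (ExtVertex W N)), InP a → a = p := by
    rintro a (rfl | rfl | rfl) ha
    · rfl
    · exact absurd ha hq
    · exact absurd ha hr
  intro a ha b hb haP hbP
  rw [key a ha haP, key b hb hbP]

variable [AddCommGroup W]

/-- The set consists of elements of `W` with sum zero. -/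
def IsZeroSum (e : Set (ExtVertex W N)) : Prop :=
  ∃ s : Finset W, ∑ x ∈ s, x = 0 ∧ e = Sum.inl '' (s : Set W)

variable (W N) in
/-- The 3-uniform hypergraph of the crossing triples and the zero-sum triples of `W`. -/
def extension [Finite W] : UniformHypergraph 3 where
  carrier := ExtVertex W N
  graph :=
    { vertexSet := Set.univ
      edgeSet := {e | e.encard = 3 ∧ (IsCrossing e ∨ IsZeroSum e)}
      subset_vertexSet_of_mem_edgeSet' := fun _ _ => Set.subset_univ _ }
  finite := Set.toFinite _
  uniform := fun _ he => he.1

lemma IsZeroSum.inW {e : Set (ExtVertex W N)} (h : IsZeroSum e) {v : ExtVertex W N} (hv : v ∈ e) :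
    InW v := by
  obtain ⟨s, -, rfl⟩ := h
  obtain ⟨w, -, rfl⟩ := hv
  exact ⟨w, rfl⟩

lemma IsZeroSum.add_eq_zero {a b c : W}
    (h : IsZeroSum (N := N) {Sum.inl a, Sum.inl b, Sum.inl c})
    (hab : a ≠ b) (hac : a ≠ c) (hbc : b ≠ c) : a + b + c = 0 := by
  classical
  obtain ⟨s, hs, he⟩ := h
  have : s = {a, b, c} := by
    have h' : (Sum.inl '' (({a, b, c} : Finset W) : Set W) : Set (ExtVertex W N)) =
        Sum.inl '' (s : Set W) := by
      rw [← he]; simp [Set.image_insert_eq]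
    exact (Finset.coe_injective (Sum.inl_injective.image_injective h')).symm
  subst this
  rw [Finset.sum_insert (by simp [hab, hac]), Finset.sum_insert (by simp [hbc]),
    Finset.sum_singleton] at hs
  rw [add_assoc, hs]

variable [Finite W]

lemma isZeroSum_of_mono {x y z : ExtVertex W N}
    (h : ({x, y, z} : Set (ExtVertex W N)) ∈ (extension W N).graph.edgeSet)
    (hm : (InP x ∧ InP y ∧ InP z) ∨ (¬ InP x ∧ ¬ InP y ∧ ¬ InP z)) :
    IsZeroSum ({x, y, z} : Set (ExtVertex W N)) := by
  obtain ⟨-, ⟨⟨u, hu, hu'⟩, ⟨v, hv, hv'⟩, -⟩ | h⟩ := h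
  · simp only [Set.mem_insert_iff, Set.mem_singleton_iff] at hu hv
    rcases hu with rfl | rfl | rfl <;> rcases hv with rfl | rfl | rfl <;> tauto
  · exact h

/-- This is where the exclusion of type PPW enters the Fano argument. -/
lemma not_inP_of_edge {x y z : ExtVertex W N}
    (h : ({x, y, z} : Set (ExtVertex W N)) ∈ (extension W N).graph.edgeSet)
    (hx : InW x) (hyz : y ≠ z) : ¬ (InP y ∧ InP z) := by
  rintro ⟨hy, hz⟩
  obtain ⟨-, ⟨-, -, h⟩ | h⟩ := h
  · exact hyz (h ⟨x, by simp, hx⟩ y (by simp) z (by simp) hy hz)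
  · exact hy.not_inW (h.inW (by simp))

/-- Each `k j` completes the pair to an edge unless it equals `v`; injectivity allows only one such
loss, hence the `+ 1`. -/
lemma ncard_range_le_coDegree_add_one {k : Fin N → ExtVertex W N} (hk : Function.Injective k)
    {u v : ExtVertex W N} (huv : u ≠ v) (hu : ∀ j, k j ≠ u)
    (h : ∀ j, IsCrossing ({k j, u, v} : Set (ExtVertex W N))) :
    N ≤ (extension W N).graph.coDegree ({u, v} : Set (ExtVertex W N)) + 1 := by
  have hT : (Set.range k).ncard = N := by
    rw [← Set.image_univ, Set.ncard_image_of_injective _ hk, Set.ncard_univ, Nat.card_fin]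
  have h₁ := Set.pred_ncard_le_ncard_sdiff_singleton (Set.range k) v
  have h₂ : (Set.range k \ {v}).ncard ≤
      (extension W N).graph.coDegree ({u, v} : Set (ExtVertex W N)) := by
    refine Set.ncard_le_ncard ?_ (Set.toFinite (α := ExtVertex W N) _)
    rintro _ ⟨⟨j, rfl⟩, hj⟩
    exact ⟨Set.encard_eq_three.mpr ⟨_, _, _, hu j, hj, huv, rfl⟩, Or.inl (h j)⟩
  omega

lemma le_coDegree_extension_add_one {u v : ExtVertex W N} (huv : u ≠ v) :
    N ≤ (extension W N).graph.coDegree ({u, v} : Set (ExtVertex W N)) + 1 := by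
  have main : ∀ {u v : ExtVertex W N}, u ≠ v → InP u →
      N ≤ (extension W N).graph.coDegree ({u, v} : Set (ExtVertex W N)) + 1 := by
    intro u v huv hu
    have hqP : ∀ q, ¬ InP (Sum.inr (Sum.inr q) : ExtVertex W N) := by
      rintro q ⟨_, h⟩; cases h
    have hqW : ∀ q, ¬ InW (Sum.inr (Sum.inr q) : ExtVertex W N) := by
      rintro q ⟨_, h⟩; cases h
    refine ncard_range_le_coDegree_add_one (k := fun q => Sum.inr (Sum.inr q))
      (Sum.inr_injective.comp Sum.inr_injective) huv (fun q h => hqP q (h ▸ hu)) fun q => ?_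
    rw [Set.insert_comm]
    exact isCrossing_triple hu (hqP q) fun _ => hqW q
  by_cases hu : InP u
  · exact main huv hu
  by_cases hv : InP v
  · have := main huv.symm hv
    rwa [Set.pair_comm v u] at this
  · exact ncard_range_le_coDegree_add_one (k := fun p => Sum.inr (Sum.inl p))
      (Sum.inr_injective.comp Sum.inl_injective) huv (fun p h => hu ⟨p, h.symm⟩) fun p =>
      isCrossing_triple ⟨p, rfl⟩ hu fun h => absurd h hv

lemma minCoDegreeGE_extension (N : ℕ) (x : ℝ) (hx : x ≤ (N : ℝ) - 1) :
    (extension W N).MinCoDegreeGE x := by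
  intro S _ hS
  have hS2 : S.encard = 2 := by
    have : S.encard + 1 = 2 + 1 := hS
    exact (ENat.add_left_injective_of_ne_top ENat.one_ne_top) this
  obtain ⟨u, v, huv, rfl⟩ := Set.encard_eq_two.mp hS2
  refine hx.trans (sub_le_iff_le_add.mpr ?_)
  exact_mod_cast le_coDegree_extension_add_one huv

end Extension

/-! ### Fano-freeness and large chromatic number for W = 𝔽₃ⁿ -/

section AffineSpace

variable {ι : Type} [Finite ι] {N : ℕ}

/-- A zero-sum triple of the extension and three further points outside `P` do not form a Pasch
configuration. -/
lemma no_pasch {a b c a' b' c' : ExtVertex (ι → ZMod 3) N}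
    (h : IsZeroSum ({a, b, c} : Set (ExtVertex (ι → ZMod 3) N)))
    (hab : a ≠ b) (hac : a ≠ c) (hbc : b ≠ c) (haa : a ≠ a')
    (hab' : a ≠ b') (hac' : a ≠ c') (hba' : b ≠ a') (hbc' : b ≠ c') (hca' : c ≠ a')
    (hcb' : c ≠ b') (hd₁ : a' ≠ b') (hd₂ : a' ≠ c') (hd₃ : b' ≠ c')
    (ha' : ¬ InP a') (hb' : ¬ InP b') (hc' : ¬ InP c')
    (h₁ : ({a, b', c'} : Set _) ∈ (extension (ι → ZMod 3) N).graph.edgeSet)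
    (h₂ : ({b, a', c'} : Set _) ∈ (extension (ι → ZMod 3) N).graph.edgeSet)
    (h₃ : ({c, a', b'} : Set _) ∈ (extension (ι → ZMod 3) N).graph.edgeSet) : False := by
  have haW : InW a := h.inW (by simp)
  have hbW : InW b := h.inW (by simp)
  have hcW : InW c := h.inW (by simp)
  have z₁ := isZeroSum_of_mono h₁ (Or.inr ⟨fun hp => hp.not_inW haW, hb', hc'⟩)
  have z₂ := isZeroSum_of_mono h₂ (Or.inr ⟨fun hp => hp.not_inW hbW, ha', hc'⟩)
  have z₃ := isZeroSum_of_mono h₃ (Or.inr ⟨fun hp => hp.not_inW hcW, ha', hb'⟩)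
  have haW' : InW a' := z₂.inW (by simp)
  have hbW' : InW b' := z₁.inW (by simp)
  have hcW' : InW c' := z₁.inW (by simp)
  obtain ⟨a, rfl⟩ := haW
  obtain ⟨b, rfl⟩ := hbW
  obtain ⟨c, rfl⟩ := hcW
  obtain ⟨a', rfl⟩ := haW'
  obtain ⟨b', rfl⟩ := hbW'
  obtain ⟨c', rfl⟩ := hcW'
  simp only [ne_eq, Sum.inl.injEq] at hab hac hbc haa hab' hac' hba' hbc' hca' hcb' hd₁ hd₂ hd₃
  have e₂ := z₂.add_eq_zero hba' hbc' hd₂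
  have e₃ := z₃.add_eq_zero hca' hcb' hd₁
  refine haa (eq_of_pasch (h.add_eq_zero hab hac hbc) (z₁.add_eq_zero hab' hac' hd₃) ?_ ?_)
  · rw [← e₂]; abel
  · rw [← e₃]; abel

lemma extension_mem_freeFamily_fano :
    extension (ι → ZMod 3) N ∈ freeFamily fano := by
  rintro ⟨f, hf, hE⟩
  let g : ZMod 7 → ExtVertex (ι → ZMod 3) N := fun j => (f ⟨j, Set.mem_univ j⟩).1
  have hg : Function.Injective g := fun a b hab =>
    congrArg Subtype.val (hf (Subtype.ext (a1 := f _) (a2 := f _) hab))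
  have hgE : ∀ i, ({g i, g (i + 1), g (i + 3)} : Set (ExtVertex (ι → ZMod 3) N)) ∈
      (extension (ι → ZMod 3) N).graph.edgeSet := by
    intro i
    have := hE _ ⟨i, rfl⟩
    convert this using 0
    refine iff_of_eq (congrArg (· ∈ (extension (ι → ZMod 3) N).graph.edgeSet) ?_)
    ext x
    simp only [Set.mem_insert_iff, Set.mem_singleton_iff]
    constructor
    · rintro (rfl | rfl | rfl)
      · exact ⟨⟨i, Set.mem_univ _⟩, Or.inl rfl, rfl⟩
      · exact ⟨⟨i + 1, Set.mem_univ _⟩, Or.inr (Or.inl rfl), rfl⟩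
      · exact ⟨⟨i + 3, Set.mem_univ _⟩, Or.inr (Or.inr rfl), rfl⟩
    · rintro ⟨⟨j, _⟩, hj, rfl⟩
      rcases hj with h | h | h
      · left; cases h; rfl
      · right; left; cases h; rfl
      · right; right; cases h; rfl
  obtain ⟨i, hi⟩ := exists_mono_fano_line fun j => InP (g j)
  have h₀ := isZeroSum_of_mono (hgE i) hi
  have ne : ∀ a b : ZMod 7, a ≠ b → g (i + a) ≠ g (i + b) := fun a b hab h =>
    hab (add_left_cancel (hg h))
  have ed : ∀ a b c : ZMod 7, (∃ j, ({j, j + 1, j + 3} : Finset (ZMod 7)) = {a, b, c}) →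
      ({g (i + a), g (i + b), g (i + c)} : Set (ExtVertex (ι → ZMod 3) N)) ∈
      (extension (ι → ZMod 3) N).graph.edgeSet := by
    rintro a b c ⟨j, hj⟩
    have h := hgE (i + j)
    have e : ∀ x y z : ZMod 7, ({g (i + x), g (i + y), g (i + z)} : Set _) =
        (fun k => g (i + k)) '' (({x, y, z} : Finset (ZMod 7)) : Set (ZMod 7)) := by
      intro x y z
      simp [Set.image_insert_eq]
    rw [add_assoc, add_assoc, e, hj, ← e] at h
    exact h
  rw [show g i = g (i + 0) by rw [add_zero]] at h₀
  have hW0 : InW (g (i + 0)) := h₀.inW (by simp)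
  have hW1 : InW (g (i + 1)) := h₀.inW (by simp)
  have hW3 : InW (g (i + 3)) := h₀.inW (by simp)
  -- The other six lines each join one point of the line {0, 1, 3} to one of the six pairs in {2, 4,
  -- 5, 6}.
  have l1 := ed 0 4 5 (by decide)
  have l2 := ed 0 2 6 (by decide)
  have l3 := ed 1 2 4 (by decide)
  have l4 := ed 1 5 6 (by decide)
  have l5 := ed 3 2 5 (by decide)
  have l6 := ed 3 4 6 (by decide)
  have n1 := not_inP_of_edge l1 hW0 (ne _ _ (by decide))
  have n2 := not_inP_of_edge l2 hW0 (ne _ _ (by decide))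
  have n3 := not_inP_of_edge l3 hW1 (ne _ _ (by decide))
  have n4 := not_inP_of_edge l4 hW1 (ne _ _ (by decide))
  have n5 := not_inP_of_edge l5 hW3 (ne _ _ (by decide))
  have n6 := not_inP_of_edge l6 hW3 (ne _ _ (by decide))
  -- At most one of the four points off the zero-sum line lies in `P`.
  have pasch : ∀ a b c : ZMod 7, [0, 1, 3, a, b, c].Nodup →
      (∃ j, ({j, j + 1, j + 3} : Finset (ZMod 7)) = {0, b, c}) →
      (∃ j, ({j, j + 1, j + 3} : Finset (ZMod 7)) = {1, a, c}) →
      (∃ j, ({j, j + 1, j + 3} : Finset (ZMod 7)) = {3, a, b}) →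
      ¬ InP (g (i + a)) → ¬ InP (g (i + b)) → ¬ InP (g (i + c)) → False := by
    intro a b c hn j₁ j₂ j₃ ha hb hc
    simp only [List.nodup_cons, List.mem_cons, List.not_mem_nil, or_false, not_or] at hn
    obtain ⟨⟨h01, h03, h0a, h0b, h0c⟩, ⟨h13, h1a, h1b, h1c⟩, ⟨h3a, h3b, h3c⟩, ⟨hab, hac⟩, hbc, -⟩ := hn
    exact no_pasch h₀ (ne _ _ h01) (ne _ _ h03) (ne _ _ h13) (ne _ _ h0a) (ne _ _ h0b) (ne _ _ h0c)
      (ne _ _ h1a) (ne _ _ h1c) (ne _ _ h3a) (ne _ _ h3b) (ne _ _ hab) (ne _ _ hac) (ne _ _ hbc)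
      ha hb hc (ed _ _ _ j₁) (ed _ _ _ j₂) (ed _ _ _ j₃)
  -- In each case the named point is the one of 2, 4, 5, 6 left out.
  have p2 := pasch 6 4 5 (by decide) (by decide) (by decide) (by decide)
  have p4 := pasch 5 2 6 (by decide) (by decide) (by decide) (by decide)
  have p5 := pasch 4 6 2 (by decide) (by decide) (by decide) (by decide)
  have p6 := pasch 2 5 4 (by decide) (by decide) (by decide) (by decide)
  by_cases h2 : InP (g (i + 2))
  · exact p2 (fun h => n2 ⟨h2, h⟩) (fun h => n3 ⟨h2, h⟩) (fun h => n5 ⟨h2, h⟩)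
  by_cases h4 : InP (g (i + 4))
  · exact p4 (fun h => n1 ⟨h4, h⟩) h2 (fun h => n6 ⟨h4, h⟩)
  by_cases h5 : InP (g (i + 5))
  · exact p5 h4 (fun h => n4 ⟨h5, h⟩) h2
  · exact p6 h2 h5 h4

lemma ncard_vertexSet_extension (W : Type) [AddCommGroup W] [Finite W] (N : ℕ) :
    (extension W N).graph.vertexSet.ncard = Nat.card W + 2 * N := by
  have := Fintype.ofFinite W
  have h : (extension W N).graph.vertexSet.ncard = Nat.card (ExtVertex W N) := Set.ncard_univ _
  rw [h, Nat.card_sum, Nat.card_sum, Nat.card_fin]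
  omega

/-- In high dimension, every coloring has a monochromatic affine line, by the Hales–Jewett
theorem. -/
lemma exists_not_isColorable_extension (t : ℕ) :
    ∃ (ι : Type) (_ : Finite ι), ∀ N : ℕ,
      ¬ (extension (ι → ZMod 3) N).graph.IsColorable t := by
  obtain ⟨ι, hι, h⟩ := Combinatorics.Line.exists_mono_in_high_dimension (ZMod 3) (Fin t)
  refine ⟨ι, inferInstance, fun N => ?_⟩
  rintro ⟨f, hf⟩
  obtain ⟨l, k, hl⟩ := h fun w => f ⟨(Sum.inl w : ExtVertex (ι → ZMod 3) N), Set.mem_univ _⟩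
  have hinj := l.apply_injective
  have h01 : l 0 ≠ l 1 := hinj.ne (by decide)
  have h02 : l 0 ≠ l 2 := hinj.ne (by decide)
  have h12 : l 1 ≠ l 2 := hinj.ne (by decide)
  have hedge : ({Sum.inl (l 0), Sum.inl (l 1), Sum.inl (l 2)} : Set (ExtVertex (ι → ZMod 3) N)) ∈
      (extension (ι → ZMod 3) N).graph.edgeSet := by
    classical
    refine ⟨Set.encard_eq_three.mpr ⟨_, _, _, Sum.inl_injective.ne h01, Sum.inl_injective.ne h02,
      Sum.inl_injective.ne h12, rfl⟩, Or.inr ⟨{l 0, l 1, l 2}, ?_, ?_⟩⟩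
    · rw [Finset.sum_insert (by simp [h01, h02]), Finset.sum_insert (by simp [h12]),
        Finset.sum_singleton, ← add_assoc, l.sum_apply_zmod_three]
    · simp [Set.image_insert_eq]
  have hcol : ∀ u : (extension (ι → ZMod 3) N).graph.vertexSet,
      u.1 ∈
        ({Sum.inl (l 0), Sum.inl (l 1), Sum.inl (l 2)} : Set (ExtVertex (ι → ZMod 3) N)) →
      f u = k := by
    rintro ⟨u, _⟩ (rfl | rfl | rfl)
    · exact hl 0
    · exact hl 1
    · exact hl 2
  obtain ⟨u, v, hu, hv, huv⟩ := hf _ hedge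
  exact huv ((hcol u hu).trans (hcol v hv).symm)

end AffineSpace

/-- If the co-degrees are at least twice the number of vertices, there is at most one vertex. -/
lemma chromaticNumber_le_one_of_minCoDegreeGE (H : UniformHypergraph 3)
    (h : H.MinCoDegreeGE (2 * (H.graph.vertexSet.ncard : ℝ))) :
    H.graph.chromaticNumber ≤ ((1 : ℕ) : ℕ∞) := by
  refine iInf₂_le (1 : ℕ) ⟨fun _ => 0, fun e he => ?_⟩
  exfalso
  have heV : e ⊆ H.graph.vertexSet := H.graph.subset_vertexSet_of_mem_edgeSet he
  obtain ⟨x, y, z, hxy, -, -, rfl⟩ := Set.encard_eq_three.mp (H.uniform e he)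
  have hS : ({x, y} : Set H.carrier) ⊆ H.graph.vertexSet := fun a ha => heV (by
    rcases ha with rfl | rfl <;> simp)
  have h2 := h {x, y} hS (by rw [Set.encard_pair hxy]; rfl)
  have h3 : H.graph.coDegree {x, y} ≤ H.graph.vertexSet.ncard := by
    refine Set.ncard_le_ncard (fun a ha => ?_) H.finite
    exact H.graph.subset_vertexSet_of_mem_edgeSet ha (Set.mem_insert _ _)
  have h4 : 0 < H.graph.vertexSet.ncard :=
    (Set.ncard_pos H.finite).mpr ⟨x, hS (by simp)⟩
  have h3' : (H.graph.coDegree {x, y} : ℝ) ≤ H.graph.vertexSet.ncard := by exact_mod_cast h3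
  have h4' : (0 : ℝ) < H.graph.vertexSet.ncard := by exact_mod_cast h4
  linarith

end UniformHypergraph

open UniformHypergraph in
theorem mainTheorem12 :
    (2 / 5 : ℝ) ≤
      UniformHypergraph.coChromaticThreshold
        (UniformHypergraph.freeFamily UniformHypergraph.fano) := by
  -- The value 2 shows that the set is nonempty; the infimum of an empty set of reals would be 0.
  refine le_csInf ⟨2, by norm_num, 1, fun H _ h => chromaticNumber_le_one_of_minCoDegreeGE H h⟩ ?_
  rintro c ⟨-, t, ht⟩
  by_contra! hc
  obtain ⟨ι, hι, hcol⟩ := exists_not_isColorable_extension t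
  let m := Nat.card (ι → ZMod 3)
  -- With N = 2m + 5 there are 5m + 10 vertices, and 2/5 of them is exactly N - 1. Larger N would
  -- serve for any c < 1/2.
  refine hcol (2 * m + 5) (Hypergraph.isColorable_of_chromaticNumber_le
    (ht _ extension_mem_freeFamily_fano (minCoDegreeGE_extension _ _ ?_)))
  rw [ncard_vertexSet_extension]
  have hm : (0 : ℝ) ≤ m := Nat.cast_nonneg m
  push_cast
  change c * ((m : ℝ) + 2 * (2 * m + 5)) ≤ 2 * m + 5 - 1
  nlinarith
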